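/- Let $G$ be a (finite-dimensional, real, smooth) Lie group with identity $e$ and Lie algebra $\mathfrak g = T_eG$, equipped with a left-invariant Riemannian metric, i.e. a smooth Riemannian metric for which every left translation $L_g : h \mapsto gh$ is an isometry. Let $\nabla$ be the Levi-Civita connection of this metric and let $D_t$ be the induced covariant derivative along curves. For $\xi, \eta \in \mathfrak g$ put $$\nabla^{\mathfrak g}_\xi \eta := (\nabla_{\phi(\xi)}\phi(\eta))(e) \in \mathfrak g,$$ where $\phi(\xi)$ is the left-invariant vector field on $G$ with $\phi(\xi)(e) = \xi$. Let $a < b$ and let $g : [a,b] \to G$ be a differentiable curve with velocity $\dot g$ (one-sided at the endpoints), and let $\xi := g^{-1}\dot g : [a,b] \to \mathfrak g$, i.e. $\xi(t) = dL_{g(t)^{-1}}(\dot g(t))$. Then $g$ is a geodesic of $\nabla$ (that is, $g$ is smooth and $D_t\dot g = 0$ on $[a,b]$) if and only if $\xi$ is differentiable on $[a,b]$ and satisfies the Euler–Poincaré equation $$\dot\xi + \nabla^{\mathfrak g}_{\xi}\xi = 0 \quad\text{on } [a,b].$$ -/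

import Mathlib

open Bundle Manifold VectorField
open scoped ContDiff Topology

noncomputable section

section Riesz

variable {V : Type*} [NormedAddCommGroup V] [InnerProductSpace ℝ V] [FiniteDimensional ℝ V]

/-- The operator `A` representing a bilinear form `B`, i.e. `⟪A v, w⟫ = B v w`. -/
def operatorOfBilin (B : V →L[ℝ] V →L[ℝ] ℝ) : V →L[ℝ] V :=
  haveI : CompleteSpace V := FiniteDimensional.complete ℝ V
  InnerProductSpace.continuousLinearMapOfBilin (𝕜 := ℝ) B

lemma inner_operatorOfBilin (B : V →L[ℝ] V →L[ℝ] ℝ) (v w : V) :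
    inner ℝ (operatorOfBilin B v) w = B v w := by
  have : CompleteSpace V := FiniteDimensional.complete ℝ V
  exact InnerProductSpace.continuousLinearMapOfBilin_apply (𝕜 := ℝ) B v w

end Riesz

section LeviCivita

instance finiteDimensional_tangentSpace {E : Type*} [NormedAddCommGroup E] [NormedSpace ℝ E]
    [FiniteDimensional ℝ E] {H : Type*} [TopologicalSpace H] (I : ModelWithCorners ℝ E H)
    {M : Type*} [TopologicalSpace M] [ChartedSpace H M] (x : M) :
    FiniteDimensional ℝ (TangentSpace I x) :=
  inferInstanceAs (FiniteDimensional ℝ E)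

set_option linter.unusedSectionVars false

variable {E : Type*} [NormedAddCommGroup E] [NormedSpace ℝ E] [FiniteDimensional ℝ E]
  {H : Type*} [TopologicalSpace H] {I : ModelWithCorners ℝ E H}
  {M : Type*} [TopologicalSpace M] [ChartedSpace H M] [IsManifold I ∞ M]
  [RiemannianBundle (fun x : M => TangentSpace I x)]
  [IsContMDiffRiemannianBundle I ∞ E (fun x : M => TangentSpace I x)]

lemma mdifferentiableAt_inner_tangent {X Y : Π x : M, TangentSpace I x} {x : M}
    (hX : MDiffAt (T% X) x) (hY : MDiffAt (T% Y) x) :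
    MDiffAt (fun y => inner ℝ (X y) (Y y)) x :=
  MDifferentiableAt.inner_bundle (F := E) (E := fun x : M => TangentSpace I x) hX hY

lemma mvfderiv_inner_add_left {X X' Y : Π x : M, TangentSpace I x} {x : M}
    (hX : MDiffAt (T% X) x) (hX' : MDiffAt (T% X') x) (hY : MDiffAt (T% Y) x) :
    d% (fun y => inner ℝ ((X + X') y) (Y y)) x
      = d% (fun y => inner ℝ (X y) (Y y)) x + d% (fun y => inner ℝ (X' y) (Y y)) x := by
  rw [← mvfderiv_fun_add (mdifferentiableAt_inner_tangent hX hY)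
    (mdifferentiableAt_inner_tangent hX' hY)]
  simp only [Pi.add_apply, inner_add_left]

lemma mvfderiv_inner_smul_left {f : M → ℝ} {X Y : Π x : M, TangentSpace I x} {x : M}
    (hf : MDiffAt f x) (hX : MDiffAt (T% X) x) (hY : MDiffAt (T% Y) x) :
    d% (fun y => inner ℝ ((f • X) y) (Y y)) x
      = f x • d% (fun y => inner ℝ (X y) (Y y)) x + (inner ℝ (X x) (Y x) : ℝ) • d% f x := by
  rw [← mvfderiv_fun_mul hf (mdifferentiableAt_inner_tangent hX hY)]
  simp only [Pi.smul_apply', real_inner_smul_left]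

lemma mvfderiv_inner_comm (X Y : Π x : M, TangentSpace I x) (x : M) :
    d% (fun y => inner ℝ (X y) (Y y)) x = d% (fun y => inner ℝ (Y y) (X y)) x := by
  simp only [real_inner_comm]

/-- Half the right-hand side of Koszul's formula, evaluated at `x`; for the Levi-Civita connection
it equals `⟪∇_X Y, Z⟫` at `x`. -/
def koszul (Y X Z : Π x : M, TangentSpace I x) (x : M) : ℝ :=
  (1 / 2 : ℝ) *
    (d% (fun y => inner ℝ (Y y) (Z y)) x (X x)
      + d% (fun y => inner ℝ (X y) (Z y)) x (Y x)
      - d% (fun y => inner ℝ (X y) (Y y)) x (Z x)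
      + inner ℝ (mlieBracket I X Y x) (Z x)
      - inner ℝ (mlieBracket I X Z x) (Y x)
      - inner ℝ (mlieBracket I Y Z x) (X x))

lemma koszul_tensorial_left {Y : Π x : M, TangentSpace I x} {x : M} (hY : MDiffAt (T% Y) x)
    (Z : Π x : M, TangentSpace I x) (hZ : MDiffAt (T% Z) x) :
    TensorialAt I E (fun X => koszul Y X Z x) x where
  smul {f X} hf hX := by
    simp only [koszul, mvfderiv_inner_smul_left hf hX hZ, mvfderiv_inner_smul_left hf hX hY,
      mlieBracket_smul_left hf hX]
    simp [inner_smul_left, inner_add_left, inner_smul_right, real_inner_comm]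
    ring
  add {X X'} hX hX' := by
    simp only [koszul, mvfderiv_inner_add_left hX hX' hZ, mvfderiv_inner_add_left hX hX' hY,
      mlieBracket_add_left hX hX']
    simp [inner_add_left, inner_add_right]
    ring

lemma koszul_tensorial_right {Y : Π x : M, TangentSpace I x} {x : M} (hY : MDiffAt (T% Y) x)
    (X : Π x : M, TangentSpace I x) (hX : MDiffAt (T% X) x) :
    TensorialAt I E (fun Z => koszul Y X Z x) x where
  smul {f Z} hf hZ := by
    simp only [koszul, mvfderiv_inner_comm X (f • Z), mvfderiv_inner_comm Y (f • Z),
      mvfderiv_inner_smul_left hf hZ hX, mvfderiv_inner_smul_left hf hZ hY,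
      mlieBracket_smul_right hf hZ]
    simp [inner_smul_left, inner_add_left, inner_smul_right, real_inner_comm]
    ring
  add {Z Z'} hZ hZ' := by
    simp only [koszul, mvfderiv_inner_comm X (Z + Z'), mvfderiv_inner_comm Y (Z + Z'),
      mvfderiv_inner_add_left hZ hZ' hX, mvfderiv_inner_add_left hZ hZ' hY,
      mlieBracket_add_right hZ hZ', mvfderiv_inner_comm X Z, mvfderiv_inner_comm Y Z]
    simp [inner_add_left, inner_add_right, real_inner_comm]
    ring

open Classical in
/-- The covariant differential `∇Y` at `x`: the operator `X ↦ ∇_X Y` determined by Koszul's formula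
`⟪∇_X Y, Z⟫ = koszul Y X Z` (and zero if `Y` is not differentiable at `x`). -/
def leviCivitaFun (Y : Π x : M, TangentSpace I x) (x : M) :
    TangentSpace I x →L[ℝ] TangentSpace I x :=
  if hY : MDiffAt (T% Y) x then
    operatorOfBilin
      (TensorialAt.mkHom₂ (fun X Z => koszul Y X Z x) x
        (koszul_tensorial_left hY) (koszul_tensorial_right hY))
  else 0

/-- Koszul's formula. -/
theorem inner_leviCivitaFun {X Y Z : Π x : M, TangentSpace I x} {x : M}
    (hX : MDiffAt (T% X) x) (hY : MDiffAt (T% Y) x) (hZ : MDiffAt (T% Z) x) :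
    inner ℝ (leviCivitaFun Y x (X x)) (Z x) = koszul Y X Z x := by
  simp only [leviCivitaFun, hY, dite_true]
  rw [inner_operatorOfBilin]
  exact TensorialAt.mkHom₂_apply _ _ hX hZ

lemma tangentOperator_ext {x : M} {A B : TangentSpace I x →L[ℝ] TangentSpace I x}
    (h : ∀ X Z : Π x : M, TangentSpace I x, MDiffAt (T% X) x → MDiffAt (T% Z) x →
      (inner ℝ (A (X x)) (Z x) : ℝ) = inner ℝ (B (X x)) (Z x)) : A = B := by
  refine ContinuousLinearMap.ext fun v => ext_inner_right ℝ fun w => ?_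
  have := h (FiberBundle.extend E v) (FiberBundle.extend E w)
    (FiberBundle.mdifferentiableAt_extend I E v) (FiberBundle.mdifferentiableAt_extend I E w)
  simpa using this

variable (I M) in
/-- The Levi-Civita connection of a Riemannian manifold; `leviCivita I M Y x (X x)` is `∇_X Y` at
`x`. It is torsion-free and metric, see `leviCivita_torsion_free` and `leviCivita_metric`, and
these properties determine it, see `eq_leviCivita`. -/
def leviCivita : CovariantDerivative I E (fun x : M => TangentSpace I x) where
  toFun := leviCivitaFun
  isCovariantDerivativeOnUniv :=
    { add := by
        intro Y Y' x hY hY' _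
        have hs : MDiffAt (T% (Y + Y')) x := mdifferentiableAt_add_section hY hY'
        refine tangentOperator_ext fun X Z hX hZ => ?_
        rw [inner_leviCivitaFun hX hs hZ, add_apply, inner_add_left,
          inner_leviCivitaFun hX hY hZ, inner_leviCivitaFun hX hY' hZ]
        simp only [koszul, mvfderiv_inner_add_left hY hY' hZ, mvfderiv_inner_comm X (Y + Y'),
          mvfderiv_inner_add_left hY hY' hX, mlieBracket_add_right hY hY',
          mlieBracket_add_left hY hY', mvfderiv_inner_comm X Y, mvfderiv_inner_comm X Y']
        simp [inner_add_left, inner_add_right]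
        ring
      leibniz := by
        intro Y f x hY hf _
        have hs : MDiffAt (T% (f • Y)) x := hf.smul_section hY
        refine tangentOperator_ext fun X Z hX hZ => ?_
        rw [inner_leviCivitaFun hX hs hZ, add_apply, inner_add_left,
          smul_apply, real_inner_smul_left, inner_leviCivitaFun hX hY hZ]
        simp only [koszul, mvfderiv_inner_smul_left hf hY hZ, mvfderiv_inner_comm X (f • Y),
          mvfderiv_inner_smul_left hf hY hX, mlieBracket_smul_right hf hY,
          mlieBracket_smul_left hf hY, mvfderiv_inner_comm X Y]
        simp [inner_smul_left, inner_add_left, inner_smul_right, real_inner_comm]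
        ring }

theorem leviCivita_torsion_free {X Y : Π x : M, TangentSpace I x} {x : M}
    (hX : MDiffAt (T% X) x) (hY : MDiffAt (T% Y) x) :
    leviCivita I M Y x (X x) - leviCivita I M X x (Y x) = mlieBracket I X Y x := by
  refine ext_inner_right ℝ fun w => ?_
  obtain ⟨Z, hZ, rfl⟩ : ∃ Z : Π x : M, TangentSpace I x, MDiffAt (T% Z) x ∧ Z x = w :=
    ⟨FiberBundle.extend E w, FiberBundle.mdifferentiableAt_extend I E w, by simp⟩
  change inner ℝ (leviCivitaFun Y x (X x) - leviCivitaFun X x (Y x)) (Z x) = _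
  rw [inner_sub_left, inner_leviCivitaFun hX hY hZ, inner_leviCivitaFun hY hX hZ]
  simp only [koszul, mvfderiv_inner_comm X Y]
  rw [mlieBracket_swap_apply (V := Y) (W := X), inner_neg_left]
  ring

theorem leviCivita_metric {X Y Z : Π x : M, TangentSpace I x} {x : M}
    (hX : MDiffAt (T% X) x) (hY : MDiffAt (T% Y) x) (hZ : MDiffAt (T% Z) x) :
    d% (fun y => inner ℝ (Y y) (Z y)) x (X x)
      = inner ℝ (leviCivita I M Y x (X x)) (Z x) + inner ℝ (Y x) (leviCivita I M Z x (X x)) := by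
  change _ = inner ℝ (leviCivitaFun Y x (X x)) (Z x) + inner ℝ (Y x) (leviCivitaFun Z x (X x))
  rw [real_inner_comm (leviCivitaFun Z x (X x)), inner_leviCivitaFun hX hY hZ,
    inner_leviCivitaFun hX hZ hY]
  simp only [koszul, mvfderiv_inner_comm Z Y]
  rw [mlieBracket_swap_apply (V := Z) (W := Y), inner_neg_left]
  ring

/-- A torsion-free metric connection agrees with the Levi-Civita connection on differentiable
vector fields. -/
theorem eq_leviCivita (cov : CovariantDerivative I E (fun x : M => TangentSpace I x))
    (htor : ∀ {X Y : Π x : M, TangentSpace I x} {x : M}, MDiffAt (T% X) x → MDiffAt (T% Y) x →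
      cov Y x (X x) - cov X x (Y x) = mlieBracket I X Y x)
    (hmet : ∀ {X Y Z : Π x : M, TangentSpace I x} {x : M},
      MDiffAt (T% X) x → MDiffAt (T% Y) x → MDiffAt (T% Z) x →
      d% (fun y => inner ℝ (Y y) (Z y)) x (X x)
        = inner ℝ (cov Y x (X x)) (Z x) + inner ℝ (Y x) (cov Z x (X x)))
    {Y : Π x : M, TangentSpace I x} {x : M} (hY : MDiffAt (T% Y) x) :
    cov Y x = leviCivita I M Y x := by
  refine tangentOperator_ext fun X Z hX hZ => ?_
  change _ = inner ℝ (leviCivitaFun Y x (X x)) (Z x)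
  rw [inner_leviCivitaFun hX hY hZ]
  simp only [koszul, hmet hX hY hZ, hmet hY hX hZ, hmet hZ hX hY, ← htor hX hY, ← htor hX hZ,
    ← htor hY hZ, inner_sub_left]
  rw [real_inner_comm (X x) (cov Y x (Z x)), real_inner_comm (X x) (cov Z x (Y x)),
    real_inner_comm (Y x) (cov Z x (X x))]
  ring

end LeviCivita

section CovariantDerivativeAlong

variable {E : Type*} [NormedAddCommGroup E] [NormedSpace ℝ E]
  {H : Type*} [TopologicalSpace H] {I : ModelWithCorners ℝ E H}
  {M : Type*} [TopologicalSpace M] [ChartedSpace H M] [IsManifold I ∞ M]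

variable (I) in
/-- The velocity at time `t` of a curve `γ` defined on `s` (one-sided at an endpoint of `s`). -/
def velocity (γ : ℝ → M) (s : Set ℝ) (t : ℝ) : TangentSpace I (γ t) :=
  mfderivWithin 𝓘(ℝ, ℝ) I γ s t (1 : ℝ)

/-- The covariant derivative `D_t V` of a vector field `V` along a curve `γ` defined on `s`.
In the local frame `(e_i)` of the tangent bundle given by the chart at `γ t` we have `V = V^i e_i`,
and `D_t V = (dV^i/dt) e_i + V^i ∇_{γ'} e_i`. The first summand below is `(dV^i/dt) e_i`, and the
second one is `∇_{γ'}` of the vector field with constant coefficients `V^i(t)`. -/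
def covDerivAlong (cov : CovariantDerivative I E (fun x : M => TangentSpace I x))
    (γ : ℝ → M) (s : Set ℝ) (V : Π t, TangentSpace I (γ t)) (t : ℝ) : TangentSpace I (γ t) :=
  let e := trivializationAt E (fun x : M => TangentSpace I x) (γ t)
  e.symm (γ t) (derivWithin (fun τ => (e ⟨γ τ, V τ⟩).2) s t)
    + cov (fun y => e.symm y (e ⟨γ t, V t⟩).2) (γ t) (velocity I γ s t)

set_option linter.unusedSectionVars false

variable [FiniteDimensional ℝ E]

lemma mdifferentiableAt_coord (e : Trivialization E (TotalSpace.proj : TangentBundle I M → M))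
    [MemTrivializationAtlas e] {W : Π x : M, TangentSpace I x} {x : M} (hx : x ∈ e.baseSet)
    (hW : MDiffAt (T% W) x) : MDiffAt (fun y => (e ⟨y, W y⟩).2) x := by
  exact (e.mdifferentiableAt_section_iff I W hx).1 hW

lemma mvfderiv_congr_of_eventuallyEq {f g : M → E} {x : M} (h : f =ᶠ[𝓝 x] g) : d% f x = d% g x := by
  ext v
  change (mfderiv I 𝓘(ℝ, E) f x v : E) = (mfderiv I 𝓘(ℝ, E) g x v : E)
  rw [h.mfderiv_eq]; rfl

/-- The flat connection of a local trivialization. -/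
lemma isCovariantDerivativeOn_flat (e : Trivialization E (TotalSpace.proj : TangentBundle I M → M))
    [MemTrivializationAtlas e] :
    IsCovariantDerivativeOn (I := I) E (V := fun x : M => TangentSpace I x)
      (fun W x => (e.symmL ℝ x).comp (d% (fun y => (e ⟨y, W y⟩).2) x)) e.baseSet where
  add {W W' x} hW hW' hx := by
    have h : (fun y => (e ⟨y, (W + W') y⟩).2) =ᶠ[𝓝 x]
        (fun y => (e ⟨y, W y⟩).2 + (e ⟨y, W' y⟩).2) := by
      filter_upwards [e.open_baseSet.mem_nhds hx] with y hy
      exact (e.linear ℝ hy).map_add _ _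
    have h2 : d% (fun y => (e ⟨y, (W + W') y⟩).2) x =
       d% (fun y => (e ⟨y, W y⟩).2 + (e ⟨y, W' y⟩).2) x := by
      exact mvfderiv_congr_of_eventuallyEq h
    rw [h2, mvfderiv_fun_add (mdifferentiableAt_coord e hx hW) (mdifferentiableAt_coord e hx hW')]
    ext v; simp
  leibniz {W f x} hW hf hx := by
    have h : (fun y => (e ⟨y, (f • W) y⟩).2) =ᶠ[𝓝 x]
        (fun y => f y • (e ⟨y, W y⟩).2) := by
      filter_upwards [e.open_baseSet.mem_nhds hx] with y hy
      exact (e.linear ℝ hy).map_smul _ _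
    have h2 : d% (fun y => (e ⟨y, (f • W) y⟩).2) x =
       d% (fun y => f y • (e ⟨y, W y⟩).2) x := by
      exact mvfderiv_congr_of_eventuallyEq h
    rw [h2, mvfderiv_fun_smul hf (mdifferentiableAt_coord e hx hW)]
    have h3 : e.symmL ℝ x (e ⟨x, W x⟩).2 = W x := by
      rw [e.symmL_apply hx, e.symm_apply_apply_mk hx]
    ext v; simp [h3]

/-- `D_t` agrees with `∇_{γ'}` on vector fields along `γ` that extend to the manifold. -/
theorem covDerivAlong_comp (cov : CovariantDerivative I E (fun x : M => TangentSpace I x))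
    {γ : ℝ → M} {s : Set ℝ} {t : ℝ} (hs : UniqueDiffWithinAt ℝ s t)
    (hγ : MDifferentiableWithinAt 𝓘(ℝ, ℝ) I γ s t)
    {W : Π x : M, TangentSpace I x} (hW : MDiffAt (T% W) (γ t)) :
    covDerivAlong cov γ s (fun τ => W (γ τ)) t = cov W (γ t) (velocity I γ s t) := by
  set e := trivializationAt E (fun x : M => TangentSpace I x) (γ t) with he
  have hx : γ t ∈ e.baseSet := FiberBundle.mem_baseSet_trivializationAt' _
  have hW' : MDiffAt (T% (FiberBundle.extend E (W (γ t)))) (γ t) :=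
    FiberBundle.mdifferentiableAt_extend I E (W (γ t))
  have h1 := IsCovariantDerivativeOn.difference_apply (cov.isCovariantDerivativeOn)
    (isCovariantDerivativeOn_flat e) hx hW
  have h2 := IsCovariantDerivativeOn.difference_apply (cov.isCovariantDerivativeOn)
    (isCovariantDerivativeOn_flat e) hx hW'
  rw [FiberBundle.extend_apply_self, h1] at h2
  have h3 : d% (fun y => (e ⟨y, FiberBundle.extend E (W (γ t)) y⟩).2) (γ t) = 0 := by
    have h : (fun y => (e ⟨y, FiberBundle.extend E (W (γ t)) y⟩).2) =ᶠ[𝓝 (γ t)]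
        (fun y => (e ⟨γ t, W (γ t)⟩).2) := by
      filter_upwards [e.open_baseSet.mem_nhds hx] with y hy
      change (e ⟨y, e.symm y (e ⟨γ t, W (γ t)⟩).2⟩).2 = _
      rw [e.apply_mk_symm hy]
    rw [mvfderiv_congr_of_eventuallyEq h]; exact mvfderiv_const _
  rw [h3] at h2
  have h4 := congrArg (fun A => A (velocity I γ s t)) h2
  have h5 : d% (fun y => (e ⟨y, W y⟩).2) (γ t) (velocity I γ s t) =
      derivWithin (fun τ => (e ⟨γ τ, W (γ τ)⟩).2) s t := by
    have h6 := mfderiv_comp_mfderivWithin t (mdifferentiableAt_coord e hx hW) hγ hs.uniqueMDiffWithinAt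
    rw [mfderivWithin_eq_fderivWithin] at h6
    have h7 := congrArg (fun A => A (1 : ℝ)) h6
    exact h7.symm
  simp [h5] at h4
  unfold covDerivAlong
  rw [sub_eq_iff_eq_add] at h4
  rw [h4, add_comm, Trivialization.symmL_apply e hx]; rfl
end CovariantDerivativeAlong

section Geodesic

variable {E : Type*} [NormedAddCommGroup E] [NormedSpace ℝ E] [FiniteDimensional ℝ E]
  {H : Type*} [TopologicalSpace H] (I : ModelWithCorners ℝ E H)
  {M : Type*} [TopologicalSpace M] [ChartedSpace H M] [IsManifold I ∞ M]
  [RiemannianBundle (fun x : M => TangentSpace I x)]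
  [IsContMDiffRiemannianBundle I ∞ E (fun x : M => TangentSpace I x)]

/-- The restriction of `γ` to `s` is a geodesic: it is smooth and `D_t γ' = 0` on `s`, where `D_t`
is the covariant derivative along `γ` induced by the Levi-Civita connection. -/
def IsGeodesicOn (γ : ℝ → M) (s : Set ℝ) : Prop :=
  ContMDiffOn 𝓘(ℝ, ℝ) I ∞ γ s ∧
    ∀ t ∈ s, covDerivAlong (leviCivita I M) γ s (velocity I γ s) t = 0

end Geodesic

section LieGroup

variable {E : Type*} [NormedAddCommGroup E] [NormedSpace ℝ E] [FiniteDimensional ℝ E]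
  {H : Type*} [TopologicalSpace H] (I : ModelWithCorners ℝ E H)
  {G : Type*} [TopologicalSpace G] [ChartedSpace H G] [Group G]

variable (G) in
/-- A Riemannian metric on a Lie group is left-invariant if all left translations are isometries. -/
def IsLeftInvariantMetric [RiemannianBundle (fun x : G => TangentSpace I x)] : Prop :=
  ∀ (g h : G) (v w : TangentSpace I h),
    (inner ℝ (mfderiv I I (fun x => g * x) h v) (mfderiv I I (fun x => g * x) h w) : ℝ) =
      inner ℝ v w

/-- The left trivialization `v ↦ g⁻¹ v` from the tangent space at `g` to the Lie algebra, i.e. the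
differential at `g` of left translation by `g⁻¹` (whose value at `g` is `1`). -/
def leftTrivialization (g : G) (v : TangentSpace I g) : GroupLieAlgebra I G :=
  mfderiv I I (fun x => g⁻¹ * x) g v

/-- The curve `g⁻¹ g'` in the Lie algebra, for a curve `g` in the group defined on `s`. -/
def reducedVelocity (g : ℝ → G) (s : Set ℝ) (t : ℝ) : GroupLieAlgebra I G :=
  leftTrivialization I (g t) (velocity I g s t)

variable [LieGroup I ∞ G] [RiemannianBundle (fun x : G => TangentSpace I x)]
  [IsContMDiffRiemannianBundle I ∞ E (fun x : G => TangentSpace I x)]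

/-- The Riemannian connection on the Lie algebra: the value at `1` of `∇_X Y`, where `X` and `Y`
are the left-invariant vector fields with `X 1 = ξ` and `Y 1 = η`. -/
def lieAlgebraConnection (ξ η : GroupLieAlgebra I G) : GroupLieAlgebra I G :=
  leviCivita I G (mulInvariantVectorField η) 1 (mulInvariantVectorField ξ 1)

/-- A differentiable curve `ξ` in the Lie algebra satisfies the Euler-Poincaré equation
`ξ' + ∇_ξ ξ = 0` on `s`. -/
def SatisfiesEulerPoincare (ξ : ℝ → GroupLieAlgebra I G) (s : Set ℝ) : Prop :=
  DifferentiableOn ℝ ξ s ∧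
    ∀ t ∈ s, derivWithin ξ s t + lieAlgebraConnection I (ξ t) (ξ t) = 0

end LieGroup

end

/-!
Let `ξ = g⁻¹ g'`. The velocity `g'` is at each time the value along `g` of the left-invariant
vector field of `ξ t`, and the theorem rests on the identity `D_t g' = g (ξ' + ∇_ξ ξ)`,
`covDerivAlong_velocity`, valid at each time at which `g` and `ξ` are differentiable. In a chart,
the coordinates of `g'` are `A (g τ) (ξ τ)`, where `A`, `leftInvariantFrame`, is a smooth family of
invertible operators. By the product rule, `D_t g'` at time `t` is the sum of `g ξ'` and of
`∇_{g'} X`, with `X` the left-invariant field of the fixed vector `ξ t`. As the metric is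
left-invariant, Koszul's formula for left-invariant fields involves only inner products and brackets
in the Lie algebra, so `∇_{g'} X = g (∇_ξ ξ)`; this is `leviCivita_mulInvariantVectorField`. Since
left translation is injective on tangent vectors, `D_t g' = 0` if and only if `ξ' + ∇_ξ ξ = 0`.

The regularity conditions of the two sides differ. If `g` is smooth then `ξ = A(g)⁻¹ u'` is
differentiable, where `u` is `g` read in the chart. Conversely, if `ξ` is differentiable and
satisfies the Euler-Poincaré equation, then the pair `(u, ξ)` solves the autonomous system
`u' = A(u) ξ`, `ξ' = -∇_ξ ξ` with smooth right-hand side, so that it is smooth by a bootstrap,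
`contDiffOn_infty_of_hasDerivWithinAt`.
-/

/-! ### Regularity of solutions of autonomous equations -/

/-- A differentiable solution of an autonomous equation `x' = F x` with `F` smooth is smooth: if `x`
is `C^n` then so is `x' = F x`, and hence `x` is `C^(n+1)`. -/
theorem contDiffOn_infty_of_hasDerivWithinAt
    {V : Type*} [NormedAddCommGroup V] [NormedSpace ℝ V] {x : ℝ → V} {F : V → V}
    {T : Set ℝ} {U : Set V} (hT : UniqueDiffOn ℝ T) (hF : ContDiffOn ℝ ∞ F U)
    (hxU : Set.MapsTo x T U) (hx : ∀ τ ∈ T, HasDerivWithinAt x (F (x τ)) T τ) :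
    ContDiffOn ℝ ∞ x T := by
  rw [contDiffOn_infty]
  intro n
  have hd : DifferentiableOn ℝ x T := fun τ hτ => (hx τ hτ).differentiableWithinAt
  induction n with
  | zero => exact contDiffOn_zero.2 hd.continuousOn
  | succ n ih =>
    push_cast
    refine (contDiffOn_succ_iff_derivWithin hT).2 ⟨hd, by simp, ?_⟩
    exact ((hF.of_le (by exact_mod_cast le_top)).comp ih hxU).congr
      fun τ hτ => (hx τ hτ).derivWithin (hT τ hτ)

/-! ### Left-invariant vector fields -/

section LeftInvariantFields

variable {E : Type*} [NormedAddCommGroup E] [NormedSpace ℝ E]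
  {H : Type*} [TopologicalSpace H] {I : ModelWithCorners ℝ E H}
  {G : Type*} [TopologicalSpace G] [ChartedSpace H G] [Group G]

theorem mulInvariantVectorField_one (v : GroupLieAlgebra I G) :
    mulInvariantVectorField v (1 : G) = v := by
  have h : (fun y : G => 1 * y) = id := by ext; simp
  rw [mulInvariantVectorField, h]
  exact congrArg (fun A => A v) (mfderiv_id (I := I) (x := (1 : G)))

variable [LieGroup I ∞ G]

/-- The regularity under which Mathlib develops the Lie algebra of a Lie group. -/
theorem lieGroup_minSmoothness_three : LieGroup I (minSmoothness ℝ 3) G :=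
  LieGroup.of_le (n := ∞) (by
    rw [minSmoothness_of_isRCLikeNormedField]
    exact WithTop.coe_le_coe.2 le_top)

/-- Left-invariant fields are `C^∞`, whereas `contMDiff_mulInvariantVectorField` gives a finite
order of smoothness. -/
theorem contMDiff_infty_mulInvariantVectorField (v : GroupLieAlgebra I G) :
    CMDiff ∞ (fun g : G => (mulInvariantVectorField v g : TangentBundle I G)) := by
  -- `v ↦ g v` is the differential of the multiplication at `(g, 1)`, applied to `(0, v)`.
  have S₁ : CMDiff ∞ (fun g : G =>
      ((TotalSpace.mk' E g 0 : TangentBundle I G), (TotalSpace.mk' E 1 v : TangentBundle I G))) :=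
    (contMDiff_zeroSection _ _).prodMk contMDiff_const
  have S₂ : CMDiff ∞ (equivTangentBundleProd I G I G).symm := contMDiff_equivTangentBundleProd_symm
  have S₃ : CMDiff ∞ (tangentMap (I.prod I) I (fun p : G × G => p.1 * p.2)) :=
    ContMDiff.contMDiff_tangentMap (contMDiff_mul I ∞) (by simp)
  convert! (S₃.comp S₂).comp S₁ with g
  · simp
  · simp only [Function.comp_apply, tangentMap]
    rw [mfderiv_prod_eq_add_apply ((contMDiff_mul I ∞).mdifferentiableAt (by simp))]
    exact ((congrArg (· + _) (map_zero _)).trans (zero_add _)).symm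

theorem mdifferentiableAt_infty_mulInvariantVectorField (v : GroupLieAlgebra I G) (x : G) :
    MDiffAt (T% (mulInvariantVectorField v)) x :=
  (contMDiff_infty_mulInvariantVectorField v x).mdifferentiableAt (by simp)

theorem mfderiv_mul_left_mfderiv_mul_left_of_mul_eq_one {g h x y : G} (hgh : g * h = 1)
    (hy : h * x = y) (v : TangentSpace I x) :
    mfderiv I I (fun z => g * z) y (mfderiv I I (fun z => h * z) x v) = v := by
  have hd : ∀ a b : G, MDifferentiableAt I I (fun z => a * z) b := fun a b =>
    (contMDiff_mul_left (n := ∞)).contMDiffAt.mdifferentiableAt (by simp)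
  have h1 := mfderiv_comp_apply_of_eq (I := I) (I' := I) (I'' := I) x
    (g := fun z => g * z) (f := fun z => h * z) (hd g y) (hd h x) hy v
  have h2 : (fun z => g * z) ∘ (fun z => h * z) = id := by
    ext z; simp [← mul_assoc, hgh]
  rw [h2, mfderiv_id] at h1
  exact h1.symm

theorem leftTrivialization_mulInvariantVectorField (g : G) (v : GroupLieAlgebra I G) :
    leftTrivialization I g (mulInvariantVectorField v g) = v :=
  mfderiv_mul_left_mfderiv_mul_left_of_mul_eq_one (I := I) (inv_mul_cancel g) (mul_one g) v

theorem mulInvariantVectorField_leftTrivialization (g : G) (v : TangentSpace I g) :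
    mulInvariantVectorField (leftTrivialization I g v) g = v :=
  mfderiv_mul_left_mfderiv_mul_left_of_mul_eq_one (I := I) (mul_inv_cancel g) (inv_mul_cancel g) v

theorem velocity_eq_mulInvariantVectorField (g : ℝ → G) (s : Set ℝ) (t : ℝ) :
    velocity I g s t = mulInvariantVectorField (reducedVelocity I g s t) (g t) :=
  (mulInvariantVectorField_leftTrivialization (g t) _).symm

end LeftInvariantFields

/-! ### The Levi-Civita connection of a left-invariant metric -/

section Connection

variable {E : Type*} [NormedAddCommGroup E] [NormedSpace ℝ E]
  {H : Type*} [TopologicalSpace H] {I : ModelWithCorners ℝ E H}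
  {G : Type*} [TopologicalSpace G] [ChartedSpace H G] [Group G]
  [RiemannianBundle (fun x : G => TangentSpace I x)]

theorem inner_mulInvariantVectorField (hinv : IsLeftInvariantMetric I G)
    (v w : TangentSpace I (1 : G)) (g : G) :
    inner ℝ (mulInvariantVectorField v g) (mulInvariantVectorField w g) = inner ℝ v w := by
  -- The differential takes values in the tangent space at `g * 1`, which equals `g`
  -- only propositionally.
  have h : ∀ x : G, g * 1 = x →
      @inner ℝ (TangentSpace I x) _ (mfderiv I I (fun y => g * y) (1 : G) v)
        (mfderiv I I (fun y => g * y) (1 : G) w) = inner ℝ v w := by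
    rintro x rfl
    exact hinv g 1 v w
  exact h g (mul_one g)

variable [FiniteDimensional ℝ E] [LieGroup I ∞ G]

/-- For left-invariant fields, Koszul's expression only involves the Lie bracket and the inner
product of the Lie algebra: inner products of left-invariant fields are constant, so that the
derivatives in it vanish. -/
theorem koszul_mulInvariantVectorField (hinv : IsLeftInvariantMetric I G)
    (u v w : TangentSpace I (1 : G)) (g : G) :
    koszul (mulInvariantVectorField u) (mulInvariantVectorField v) (mulInvariantVectorField w) g =
      (1 / 2 : ℝ) * (inner ℝ (⁅v, u⁆ : TangentSpace I (1 : G)) w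
        - inner ℝ (⁅v, w⁆ : TangentSpace I (1 : G)) u
        - inner ℝ (⁅u, w⁆ : TangentSpace I (1 : G)) v) := by
  have : CompleteSpace E := FiniteDimensional.complete ℝ E
  have : LieGroup I (minSmoothness ℝ 3) G := lieGroup_minSmoothness_three
  have hconst : ∀ (a b : GroupLieAlgebra I G) (z : TangentSpace I g),
      d% (fun y => inner ℝ (mulInvariantVectorField a y) (mulInvariantVectorField b y)) g z
        = 0 := by
    intro a b z
    simp only [inner_mulInvariantVectorField hinv]
    rw [mvfderiv_const]
    rfl
  have hbracket : ∀ a b c : TangentSpace I (1 : G),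
      inner ℝ (mlieBracket I (mulInvariantVectorField a) (mulInvariantVectorField b) g)
        (mulInvariantVectorField c g) = inner ℝ (⁅a, b⁆ : TangentSpace I (1 : G)) c := by
    intro a b c
    rw [← mulInvariantVector_mlieBracket, inner_mulInvariantVectorField hinv,
      GroupLieAlgebra.bracket_def]
  simp only [koszul, hconst, hbracket]
  ring

variable [IsContMDiffRiemannianBundle I ∞ E (fun x : G => TangentSpace I x)]

/-- The Levi-Civita connection of a left-invariant metric preserves left-invariance: if `X` and `Y`
are left-invariant, then so is `∇_X Y`. -/
theorem leviCivita_mulInvariantVectorField (hinv : IsLeftInvariantMetric I G)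
    (v w : TangentSpace I (1 : G)) (g : G) :
    leviCivita I G (mulInvariantVectorField w) g (mulInvariantVectorField v g) =
      mulInvariantVectorField (lieAlgebraConnection I v w) g := by
  refine ext_inner_right ℝ fun z => ?_
  obtain ⟨ζ, rfl⟩ : ∃ ζ : TangentSpace I (1 : G), mulInvariantVectorField ζ g = z :=
    ⟨_, mulInvariantVectorField_leftTrivialization g z⟩
  -- The right-hand side below does not depend on `x`; compare `x = g` with `x = 1`.
  have key : ∀ x : G, inner ℝ (leviCivita I G (mulInvariantVectorField w) x
      (mulInvariantVectorField v x)) (mulInvariantVectorField ζ x) =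
      (1 / 2 : ℝ) * (inner ℝ (⁅v, w⁆ : TangentSpace I (1 : G)) ζ
        - inner ℝ (⁅v, ζ⁆ : TangentSpace I (1 : G)) w
        - inner ℝ (⁅w, ζ⁆ : TangentSpace I (1 : G)) v) := by
    intro x
    rw [← koszul_mulInvariantVectorField hinv w v ζ x]
    exact inner_leviCivitaFun (mdifferentiableAt_infty_mulInvariantVectorField v x)
      (mdifferentiableAt_infty_mulInvariantVectorField w x)
      (mdifferentiableAt_infty_mulInvariantVectorField ζ x)
  rw [key, inner_mulInvariantVectorField hinv, ← key 1, mulInvariantVectorField_one ζ]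
  rfl

theorem lieAlgebraConnection_add_left (v v' w : GroupLieAlgebra I G) :
    lieAlgebraConnection I (v + v') w =
      lieAlgebraConnection I v w + lieAlgebraConnection I v' w := by
  unfold lieAlgebraConnection
  rw [mulInvariantVectorField_add]
  exact map_add _ _ _

theorem lieAlgebraConnection_smul_left (c : ℝ) (v w : GroupLieAlgebra I G) :
    lieAlgebraConnection I (c • v) w = c • lieAlgebraConnection I v w := by
  unfold lieAlgebraConnection
  rw [mulInvariantVectorField_smul]
  exact map_smul _ _ _

theorem lieAlgebraConnection_add_right (v w w' : GroupLieAlgebra I G) :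
    lieAlgebraConnection I v (w + w') =
      lieAlgebraConnection I v w + lieAlgebraConnection I v w' := by
  unfold lieAlgebraConnection
  rw [mulInvariantVectorField_add, (leviCivita I G).isCovariantDerivativeOn.add
    (mdifferentiableAt_infty_mulInvariantVectorField w 1)
    (mdifferentiableAt_infty_mulInvariantVectorField w' 1) (Set.mem_univ _)]
  rfl

theorem lieAlgebraConnection_smul_right (c : ℝ) (v w : GroupLieAlgebra I G) :
    lieAlgebraConnection I v (c • w) = c • lieAlgebraConnection I v w := by
  unfold lieAlgebraConnection
  rw [mulInvariantVectorField_smul, (leviCivita I G).isCovariantDerivativeOn.smul_const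
    c (mdifferentiableAt_infty_mulInvariantVectorField w 1) (Set.mem_univ _)]
  rfl

variable (I G) in
/-- The Riemannian connection on the Lie algebra as a continuous bilinear map, with the Lie algebra
identified with the model space `E`, whose norm it uses. -/
noncomputable def lieAlgebraConnectionL : E →L[ℝ] E →L[ℝ] E :=
  LinearMap.toContinuousLinearMap <| LinearMap.toContinuousLinearMap.toLinearMap ∘ₗ
    LinearMap.mk₂ ℝ (fun v w : E => (lieAlgebraConnection I (G := G) v w : E))
      lieAlgebraConnection_add_left lieAlgebraConnection_smul_left
      lieAlgebraConnection_add_right lieAlgebraConnection_smul_right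

end Connection

/-! ### Left-invariant fields in charts -/

section Frame

variable {E : Type*} [NormedAddCommGroup E] [NormedSpace ℝ E]
  {H : Type*} [TopologicalSpace H] {I : ModelWithCorners ℝ E H}
  {G : Type*} [TopologicalSpace G] [ChartedSpace H G] [Group G] [LieGroup I ∞ G]

variable (I) in
/-- The left-invariant vector fields read in the tangent bundle chart at `x₀`: the operator sending
`v` in the Lie algebra, identified with `E`, to the coordinates of the left-invariant field of `v`
at `x`. It is meaningful for `x` in the domain of the chart at `x₀`, and zero for other `x`. -/
noncomputable def leftInvariantFrame (x₀ x : G) : E →L[ℝ] E :=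
  ((trivializationAt E (fun y : G => TangentSpace I y) x₀).continuousLinearMapAt ℝ x).comp
    (mfderiv I I (fun y => x * y) (1 : G) : E →L[ℝ] TangentSpace I x)

theorem leftInvariantFrame_apply {x₀ x : G} (hx : x ∈ (chartAt H x₀).source)
    (v : GroupLieAlgebra I G) :
    leftInvariantFrame I x₀ x v =
      (trivializationAt E (fun y : G => TangentSpace I y) x₀
        ⟨x, mulInvariantVectorField v x⟩).2 := by
  let e := trivializationAt E (fun y : G => TangentSpace I y) x₀
  exact congrFun (e.coe_linearMapAt_of_mem (R := ℝ) hx) (mulInvariantVectorField v x)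

theorem isInvertible_leftInvariantFrame {x₀ x : G} (hx : x ∈ (chartAt H x₀).source) :
    (leftInvariantFrame I x₀ x).IsInvertible := by
  let e := trivializationAt E (fun y : G => TangentSpace I y) x₀
  have h1 : (e.continuousLinearMapAt ℝ x : TangentSpace I x →L[ℝ] E).IsInvertible :=
    ⟨e.continuousLinearEquivAt ℝ x hx, by
      ext v; exact (congrFun (e.coe_linearMapAt_of_mem (R := ℝ) hx) v).symm⟩
  have h2 : (mfderiv I I (fun y => x * y) (1 : G) : E →L[ℝ] TangentSpace I x).IsInvertible :=
    ⟨ContinuousLinearEquiv.equivOfInverse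
      (mfderiv I I (fun y => x * y) (1 : G) : E →L[ℝ] TangentSpace I x)
      (mfderiv I I (fun y => x⁻¹ * y) x : TangentSpace I x →L[ℝ] E)
      (leftTrivialization_mulInvariantVectorField x) (mulInvariantVectorField_leftTrivialization x),
      by ext v; rfl⟩
  exact h1.comp h2

/-- A curve `g` read in a chart, `u`, satisfies `u' = A(g) ξ` with `ξ` its reduced velocity and `A`
the left-invariant frame. -/
theorem hasDerivWithinAt_extChartAt_comp {g : ℝ → G} {s : Set ℝ} {t : ℝ} {x₀ : G}
    (hs : UniqueDiffWithinAt ℝ s t) (hg : MDifferentiableWithinAt 𝓘(ℝ, ℝ) I g s t)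
    (hx : g t ∈ (chartAt H x₀).source) :
    HasDerivWithinAt (extChartAt I x₀ ∘ g)
      (leftInvariantFrame I x₀ (g t) (reducedVelocity I g s t)) s t := by
  have h1 := mdifferentiableAt_extChartAt (I := I) hx
  have h2 := (h1.comp_mdifferentiableWithinAt t hg).differentiableWithinAt.hasDerivWithinAt
  convert! h2 using 1
  have h3 := mfderiv_comp_mfderivWithin t h1 hg hs.uniqueMDiffWithinAt
  rw [mfderivWithin_eq_fderivWithin,
    ← TangentBundle.continuousLinearMapAt_trivializationAt hx] at h3
  have h4 := congrArg (fun A => A (1 : ℝ)) h3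
  refine Eq.trans ?_ h4.symm
  let e := trivializationAt E (fun y : G => TangentSpace I y) x₀
  exact congrArg (e.continuousLinearMapAt ℝ (g t))
    (velocity_eq_mulInvariantVectorField g s t).symm

theorem eventuallyEq_leftInvariantFrame {g : ℝ → G} {s : Set ℝ} {t : ℝ} {x₀ : G}
    (hg : ContinuousWithinAt g s t) (hx : g t ∈ (chartAt H x₀).source) :
    (fun τ => leftInvariantFrame I x₀ (g τ)) =ᶠ[𝓝[s] t]
      (fun z => leftInvariantFrame I x₀ ((extChartAt I x₀).symm z)) ∘ (extChartAt I x₀ ∘ g) := by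
  filter_upwards [hg.preimage_mem_nhdsWithin ((chartAt H x₀).open_source.mem_nhds hx)] with τ hτ
  rw [Function.comp_apply, Function.comp_apply,
    (extChartAt I x₀).left_inv (by rwa [extChartAt_source])]

variable [FiniteDimensional ℝ E]

theorem contDiffOn_leftInvariantFrame (x₀ : G) :
    ContDiffOn ℝ ∞ (fun z => leftInvariantFrame I x₀ ((extChartAt I x₀).symm z))
      (extChartAt I x₀).target := by
  rw [contDiffOn_clm_apply]
  intro v
  let e := trivializationAt E (fun y : G => TangentSpace I y) x₀
  have h1 : ContMDiffOn I 𝓘(ℝ, E) ∞ (fun x => leftInvariantFrame I x₀ x v)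
      (chartAt H x₀).source := by
    refine ContMDiffOn.congr
      (f := fun x => (e ⟨x, mulInvariantVectorField (I := I) (G := G) v x⟩).2) ?_
      fun x hx => leftInvariantFrame_apply hx v
    exact fun x hx => ((e.contMDiffAt_section_iff hx).1
      (contMDiff_infty_mulInvariantVectorField (I := I) (G := G) v x)).contMDiffWithinAt
  exact (h1.comp (contMDiffOn_extChartAt_symm x₀) fun z hz => by
    simpa using (extChartAt I x₀).map_target hz).contDiffOn

theorem contDiffAt_leftInvariantFrame [I.Boundaryless] {x₀ x : G}
    (hx : x ∈ (chartAt H x₀).source) :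
    ContDiffAt ℝ ∞ (fun z => leftInvariantFrame I x₀ ((extChartAt I x₀).symm z))
      (extChartAt I x₀ x) :=
  (contDiffOn_leftInvariantFrame x₀).contDiffAt ((isOpen_extChartAt_target x₀).mem_nhds
    ((extChartAt I x₀).map_source (by rwa [extChartAt_source])))

theorem differentiableWithinAt_leftInvariantFrame [I.Boundaryless] {g : ℝ → G} {s : Set ℝ} {t : ℝ}
    {x₀ : G} (hs : UniqueDiffWithinAt ℝ s t) (hg : MDifferentiableWithinAt 𝓘(ℝ, ℝ) I g s t)
    (hx : g t ∈ (chartAt H x₀).source) :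
    DifferentiableWithinAt ℝ (fun τ => leftInvariantFrame I x₀ (g τ)) s t := by
  have h := ((contDiffAt_leftInvariantFrame hx).differentiableAt
    (by simp)).comp_differentiableWithinAt t
    (hasDerivWithinAt_extChartAt_comp hs hg hx).differentiableWithinAt
  exact h.congr_of_eventuallyEq (eventuallyEq_leftInvariantFrame hg.continuousWithinAt hx)
    (by rw [Function.comp_apply, Function.comp_apply,
      (extChartAt I x₀).left_inv (by rwa [extChartAt_source])])

theorem differentiableWithinAt_reducedVelocity [I.Boundaryless] {g : ℝ → G} {s : Set ℝ} {t : ℝ}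
    (hs : UniqueDiffOn ℝ s) (ht : t ∈ s) (hg : ContMDiffOn 𝓘(ℝ, ℝ) I ∞ g s) :
    DifferentiableWithinAt ℝ (reducedVelocity I g s) s t := by
  have hx : g t ∈ (chartAt H (g t)).source := mem_chart_source H (g t)
  have hgd : MDifferentiableOn 𝓘(ℝ, ℝ) I g s := hg.mdifferentiableOn (by simp)
  have hu : ContDiffWithinAt ℝ ∞ (extChartAt I (g t) ∘ g) s t :=
    (contMDiffWithinAt_iff_target.1 (hg t ht)).2.contDiffWithinAt
  have hu' : DifferentiableWithinAt ℝ
      (fun τ => fderivWithin ℝ (extChartAt I (g t) ∘ g) s τ 1) s t :=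
    ((hu.fderivWithin_right (m := 1) hs (WithTop.coe_le_coe.2 le_top) ht).differentiableWithinAt
      (by simp)).clm_apply (differentiableWithinAt_const _)
  have hA : DifferentiableWithinAt ℝ
      (fun τ => (leftInvariantFrame I (g t) (g τ)).inverse) s t := by
    have : CompleteSpace E := FiniteDimensional.complete ℝ E
    exact ((isInvertible_leftInvariantFrame hx).contDiffAt_map_inverse (n := 1)
      |>.differentiableAt (by simp)).comp_differentiableWithinAt t
        (differentiableWithinAt_leftInvariantFrame (hs t ht) (hgd t ht) hx)
  -- In the chart `u` at `g t`, the reduced velocity is `A(g)⁻¹ u'`.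
  refine DifferentiableWithinAt.congr_of_eventuallyEq_of_mem (F := E) (hA.clm_apply hu') ?_ ht
  filter_upwards [self_mem_nhdsWithin, (hgd t ht).continuousWithinAt.preimage_mem_nhdsWithin
    ((chartAt H (g t)).open_source.mem_nhds hx)] with τ hτs hτ
  rw [fderivWithin_derivWithin,
    (hasDerivWithinAt_extChartAt_comp (hs τ hτs) (hgd τ hτs) hτ).derivWithin (hs τ hτs)]
  exact ((isInvertible_leftInvariantFrame hτ).inverse_apply_eq.2 rfl).symm

end Frame

/-! ### The covariant derivative of the velocity -/

section EulerPoincare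

variable {E : Type*} [NormedAddCommGroup E] [NormedSpace ℝ E] [FiniteDimensional ℝ E]
  {H : Type*} [TopologicalSpace H] {I : ModelWithCorners ℝ E H}
  {G : Type*} [TopologicalSpace G] [ChartedSpace H G] [Group G] [LieGroup I ∞ G]
  [RiemannianBundle (fun x : G => TangentSpace I x)]
  [IsContMDiffRiemannianBundle I ∞ E (fun x : G => TangentSpace I x)]

/-- The covariant derivative of the velocity `g'` is `g (ξ' + ∇_ξ ξ)`, where `ξ = g⁻¹ g'`. -/
theorem covDerivAlong_velocity [I.Boundaryless] (hinv : IsLeftInvariantMetric I G)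
    {g : ℝ → G} {s : Set ℝ} {t : ℝ} (hs : UniqueDiffWithinAt ℝ s t) (ht : t ∈ s)
    (hg : MDifferentiableWithinAt 𝓘(ℝ, ℝ) I g s t)
    (hξ : DifferentiableWithinAt ℝ (reducedVelocity I g s) s t) :
    covDerivAlong (leviCivita I G) g s (velocity I g s) t =
      mulInvariantVectorField (derivWithin (reducedVelocity I g s) s t +
        lieAlgebraConnection I (reducedVelocity I g s t) (reducedVelocity I g s t)) (g t) := by
  -- The Lie algebra is viewed as `E`, which has the norm that the product rule needs.
  let ξ : ℝ → E := reducedVelocity I g s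
  let ξ' : E := derivWithin (reducedVelocity I g s) s t
  have hξ' : HasDerivWithinAt ξ ξ' s t := DifferentiableWithinAt.hasDerivWithinAt (F := E) hξ
  let e := trivializationAt E (fun y : G => TangentSpace I y) (g t)
  have hx : g t ∈ (chartAt H (g t)).source := mem_chart_source H (g t)
  have hA := (differentiableWithinAt_leftInvariantFrame hs hg hx).hasDerivWithinAt
  set A : ℝ → E →L[ℝ] E := fun τ => leftInvariantFrame I (g t) (g τ)
  set A' : E →L[ℝ] E := derivWithin A s t
  have hnhds := hg.continuousWithinAt.preimage_mem_nhdsWithin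
    ((chartAt H (g t)).open_source.mem_nhds hx)
  -- By the product rule, the coordinates of `g'` and those of the left-invariant field of the fixed
  -- vector `ξ t` along `g` have derivatives that differ by `A t ξ'`.
  have h1 : derivWithin (fun τ => (e ⟨g τ, velocity I g s τ⟩).2) s t = A' (ξ t) + A t ξ' := by
    refine ((hA.clm_apply hξ').congr_of_eventuallyEq_of_mem ?_ ht).derivWithin hs
    filter_upwards [hnhds] with τ hτ
    rw [velocity_eq_mulInvariantVectorField]
    exact (leftInvariantFrame_apply hτ (ξ τ)).symm
  have h2 : derivWithin (fun τ => (e ⟨g τ, mulInvariantVectorField (I := I) (ξ t) (g τ)⟩).2) s t =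
      A' (ξ t) := by
    have h := (hA.clm_apply (hasDerivWithinAt_const t s (ξ t))).congr_deriv
      ((congrArg (A' (ξ t) + ·) (map_zero (A t))).trans (add_zero _))
    refine (h.congr_of_eventuallyEq_of_mem ?_ ht).derivWithin hs
    filter_upwards [hnhds] with τ hτ
    exact (leftInvariantFrame_apply hτ (ξ t)).symm
  have h3 : e.symm (g t) (A t ξ') = mulInvariantVectorField (I := I) ξ' (g t) :=
    (congrArg (e.symm (g t)) (leftInvariantFrame_apply hx ξ')).trans (e.symm_apply_apply_mk hx _)
  have h4 := covDerivAlong_comp (leviCivita I G) hs hg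
    (mdifferentiableAt_infty_mulInvariantVectorField (ξ t) (g t))
  rw [velocity_eq_mulInvariantVectorField] at h4
  replace h4 := h4.trans (leviCivita_mulInvariantVectorField hinv _ _ (g t))
  rw [mulInvariantVectorField_add]
  refine Eq.trans ?_ (congrArg₂ (· + ·) h3 h4)
  have hadd : ∀ p q : E, e.symm (g t) (p + q) = e.symm (g t) p + e.symm (g t) q := by
    intro p q
    have h := (e.symmₗ ℝ (g t)).map_add p q
    rwa [e.coe_symmₗ hx] at h
  have h5 : e.symm (g t) (derivWithin (fun τ => (e ⟨g τ, velocity I g s τ⟩).2) s t) =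
      e.symm (g t) (A t ξ') + e.symm (g t)
        (derivWithin (fun τ => (e ⟨g τ, mulInvariantVectorField (I := I) (ξ t) (g τ)⟩).2) s t) := by
    rw [h1, h2, add_comm]
    exact hadd _ _
  have h6 : velocity I g s t = mulInvariantVectorField (I := I) (ξ t) (g t) :=
    velocity_eq_mulInvariantVectorField g s t
  unfold covDerivAlong
  refine (congrArg₂ (· + ·) h5 ?_).trans (add_assoc _ _ _)
  exact congrArg (fun v : TangentSpace I (g t) =>
    leviCivita I G (fun y => e.symm y (e ⟨g t, v⟩).2) (g t) (velocity I g s t)) h6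

/-- If the reduced velocity of a differentiable curve satisfies the Euler-Poincaré equation, the
curve is smooth: locally, the curve and its reduced velocity solve an autonomous equation with
smooth right-hand side. -/
theorem contMDiffOn_of_satisfiesEulerPoincare
    {g : ℝ → G} {s : Set ℝ} (hs : UniqueDiffOn ℝ s)
    (hg : MDifferentiableOn 𝓘(ℝ, ℝ) I g s)
    (hξ : SatisfiesEulerPoincare I (reducedVelocity I g s) s) :
    ContMDiffOn 𝓘(ℝ, ℝ) I ∞ g s := by
  intro t ht
  have hx : g t ∈ (chartAt H (g t)).source := mem_chart_source H (g t)
  obtain ⟨O, hO, hgO⟩ := continuousOn_iff'.1 hg.continuousOn _ (chartAt H (g t)).open_source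
  have hsub : s ∩ O ⊆ g ⁻¹' (chartAt H (g t)).source := fun τ hτ =>
    (hgO.symm.subset ⟨hτ.2, hτ.1⟩).1
  have htO : t ∈ O := (hgO.subset ⟨hx, ht⟩).1
  -- `g` in the chart at `g t`, together with `ξ`, solves an autonomous equation with right-hand
  -- side `F`.
  let F : E × E → E × E := fun p =>
    (leftInvariantFrame I (g t) ((extChartAt I (g t)).symm p.1) p.2,
      -lieAlgebraConnectionL I G p.2 p.2)
  have hF : ContDiffOn ℝ ∞ F ((extChartAt I (g t)).target ×ˢ Set.univ) := by
    refine ContDiffOn.prodMk ?_ ?_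
    · exact ((contDiffOn_leftInvariantFrame (g t)).comp contDiffOn_fst fun p hp => hp.1).clm_apply
        contDiffOn_snd
    · exact ((((lieAlgebraConnectionL I G).contDiff.comp contDiff_snd).clm_apply
        contDiff_snd).neg).contDiffOn
  let ξ : ℝ → E := reducedVelocity I g s
  have hξ' : ∀ τ ∈ s, HasDerivWithinAt ξ (-lieAlgebraConnectionL I G (ξ τ) (ξ τ)) s τ := by
    intro τ hτ
    have h : HasDerivWithinAt ξ (derivWithin (reducedVelocity I g s) s τ) s τ :=
      DifferentiableWithinAt.hasDerivWithinAt (F := E) (hξ.1 τ hτ)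
    exact h.congr_deriv (eq_neg_of_add_eq_zero_left (hξ.2 τ hτ))
  let x : ℝ → E × E := fun τ => (extChartAt I (g t) (g τ), ξ τ)
  have hx' : ContDiffOn ℝ ∞ x (s ∩ O) := by
    refine contDiffOn_infty_of_hasDerivWithinAt (hs.inter hO) hF (fun τ hτ => ⟨?_, trivial⟩) ?_
    · exact (extChartAt I (g t)).map_source (by rw [extChartAt_source]; exact hsub hτ)
    · intro τ hτ
      refine HasDerivWithinAt.prodMk ?_ ((hξ' τ hτ.1).mono Set.inter_subset_left)
      refine ((hasDerivWithinAt_extChartAt_comp (hs τ hτ.1) (hg τ hτ.1) (hsub hτ)).mono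
        Set.inter_subset_left).congr_deriv ?_
      change _ = leftInvariantFrame I (g t) ((extChartAt I (g t)).symm (extChartAt I (g t) (g τ))) _
      rw [(extChartAt I (g t)).left_inv (by rw [extChartAt_source]; exact hsub hτ)]
  refine contMDiffWithinAt_iff_target.2 ⟨hg.continuousOn t ht, ?_⟩
  refine (contMDiffWithinAt_inter (hO.mem_nhds htO)).1 ?_
  exact (contDiff_fst.comp_contDiffOn hx' t ⟨ht, htO⟩).contMDiffWithinAt

end EulerPoincare

theorem mainTheorem3
    {E : Type*} [NormedAddCommGroup E] [NormedSpace ℝ E] [FiniteDimensional ℝ E]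
    {H : Type*} [TopologicalSpace H] (I : ModelWithCorners ℝ E H) [I.Boundaryless]
    {G : Type*} [TopologicalSpace G] [ChartedSpace H G] [Group G] [LieGroup I ∞ G]
    [RiemannianBundle (fun x : G => TangentSpace I x)]
    [IsContMDiffRiemannianBundle I ∞ E (fun x : G => TangentSpace I x)]
    (hinv : IsLeftInvariantMetric I G)
    {a b : ℝ} (hab : a < b) (g : ℝ → G)
    (hg : MDifferentiableOn 𝓘(ℝ, ℝ) I g (Set.Icc a b)) :
    IsGeodesicOn I g (Set.Icc a b) ↔
      SatisfiesEulerPoincare I (reducedVelocity I g (Set.Icc a b)) (Set.Icc a b) := by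
  have hs : UniqueDiffOn ℝ (Set.Icc a b) := uniqueDiffOn_Icc hab
  constructor
  · rintro ⟨hsmooth, hgeod⟩
    have hξ : DifferentiableOn ℝ (reducedVelocity I g (Set.Icc a b)) (Set.Icc a b) :=
      fun t ht => differentiableWithinAt_reducedVelocity hs ht hsmooth
    refine ⟨hξ, fun t ht => ?_⟩
    have h := hgeod t ht
    rw [covDerivAlong_velocity hinv (hs t ht) ht (hg t ht) (hξ t ht)] at h
    rw [← leftTrivialization_mulInvariantVectorField (I := I) (g t) (_ + _), h]
    exact map_zero _
  · intro hξ
    refine ⟨contMDiffOn_of_satisfiesEulerPoincare hs hg hξ, fun t ht => ?_⟩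
    rw [covDerivAlong_velocity hinv (hs t ht) ht (hg t ht) (hξ.1 t ht), hξ.2 t ht]
    exact map_zero _
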